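/- Let $\mathrm{Sym}(\mathbb{Z})$ be the group of finitely supported permutations of $\mathbb{Z}$, and let $G=\mathrm{Sym}(\mathbb{Z})\rtimes\mathbb{Z}$, where the generator of $\mathbb{Z}$ acts on $\mathrm{Sym}(\mathbb{Z})$ by conjugation by the shift $x\mapsto x+1$. For a unitary representation $\pi$ of $G$ on a complex Hilbert space $\mathcal{H}$, let $Z^1(G,\pi)$ be the space of maps $b:G\to\mathcal{H}$ with $b(gh)=b(g)+\pi_g b(h)$ for all $g,h\in G$, with the topology of uniform convergence on finite subsets of $G$, let $B^1(G,\pi)$ be the subspace of the maps $g\mapsto v-\pi_g v$ with $v\in\mathcal{H}$, and let $\overline{H}^1(G,\pi)=Z^1(G,\pi)/\overline{B^1(G,\pi)}$. The group $G$ has property $H_{\mathrm{FD}}$ if every unitary representation $\pi$ of $G$ with $\overline{H}^1(G,\pi)\neq 0$ has a non-zero finite-dimensional subrepresentation. Then $G$ is finitely generated and locally-finite-by-$\mathbb{Z}$ (that is, there is a surjective homomorphism $G\to\mathbb{Z}$ whose kernel $L$ is locally finite: every finite subset of $L$ lies in a finite subgroup of $L$), and $G$ does not have property $H_{\mathrm{FD}}$.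 -/

import Mathlib

universe u v

/-! ### The group `Sym(ℤ) ⋊ ℤ` -/

/-- `Sym(ℤ)`: the group of finitely supported permutations of `ℤ`. -/
def SymZ : Subgroup (Equiv.Perm ℤ) where
  carrier := {σ | {x : ℤ | σ x ≠ x}.Finite}
  one_mem' := by simp
  mul_mem' := by
    intro σ τ hσ hτ
    refine (Set.Finite.union hσ hτ).subset ?_
    intro x hx
    by_contra h
    simp only [Set.mem_union, Set.mem_ofPred_eq, not_or, not_not] at h
    exact hx (by rw [Equiv.Perm.mul_apply, h.2, h.1])
  inv_mem' := by
    intro σ hσ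
    refine Set.Finite.subset hσ ?_
    intro x hx h
    exact hx (Equiv.Perm.inv_eq_iff_eq.mpr h.symm)

instance SymZ.normal : SymZ.Normal where
  conj_mem := by
    intro σ hσ τ
    refine (Set.Finite.image τ hσ).subset ?_
    intro x hx
    refine ⟨τ⁻¹ x, ?_, by simp⟩
    intro h
    exact hx (by rw [Equiv.Perm.mul_apply, Equiv.Perm.mul_apply, h]; simp)

/-- The action of `ℤ` on `Sym(ℤ)`: the generator acts as conjugation by the
shift `x ↦ x + 1`. -/
def shiftAction : Multiplicative ℤ →* MulAut SymZ :=
  MulAut.conjNormal.comp (zpowersHom (Equiv.Perm ℤ) (Equiv.addRight (1 : ℤ)))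

/-- The group `Sym(ℤ) ⋊ ℤ`. -/
abbrev SymZExt : Type := SemidirectProduct SymZ (Multiplicative ℤ) shiftAction

/-! ### Locally-finite-by-`ℤ` groups -/

/-- A group is locally finite if every finite subset lies in a finite subgroup. -/
def IsLocallyFiniteGroup (G : Type u) [Group G] : Prop :=
  ∀ s : Set G, s.Finite → ∃ K : Subgroup G, s ⊆ K ∧ (K : Set G).Finite

/-- `G` is locally-finite-by-`ℤ`: there is an exact sequence `1 → L → G → ℤ → 1` with `L`
locally finite. -/
def IsLocallyFiniteByZ (G : Type u) [Group G] : Prop :=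
  ∃ p : G →* Multiplicative ℤ, Function.Surjective p ∧ IsLocallyFiniteGroup p.ker

/-! ### Reduced first cohomology and property `H_FD` -/

section Cohomology

/-- The space `Z¹(G, π)` of `1`-cocycles of a unitary representation `π` of `G` (a homomorphism
into the group of surjective linear isometries of a Hilbert space), with the topology of pointwise
convergence on `G`, which is uniform convergence on finite subsets of `G`. -/
def cocyclesOne {G : Type u} [Group G] {H : Type v} [NormedAddCommGroup H]
    [InnerProductSpace ℂ H] (π : G →* (H ≃ₗᵢ[ℂ] H)) : Submodule ℂ (G → H) where
  carrier := {b | ∀ g h : G, b (g * h) = b g + π g (b h)}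
  zero_mem' := by intro g h; simp
  add_mem' := by
    intro b c hb hc g h
    simp only [Pi.add_apply, hb g h, hc g h, map_add]
    abel
  smul_mem' := by
    intro a b hb g h
    simp only [Pi.smul_apply, hb g h, map_smul, smul_add]

/-- The subspace `B¹(G, π)` of `1`-coboundaries `g ↦ v - π g v` in `Z¹(G, π)`. -/
def coboundariesOne {G : Type u} [Group G] {H : Type v} [NormedAddCommGroup H]
    [InnerProductSpace ℂ H] (π : G →* (H ≃ₗᵢ[ℂ] H)) : Submodule ℂ (cocyclesOne π) where
  carrier := {b | ∃ w : H, ∀ g : G, b.1 g = w - π g w}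
  zero_mem' := ⟨0, by intro g; simp⟩
  add_mem' := by
    rintro b c ⟨w, hw⟩ ⟨w', hw'⟩
    refine ⟨w + w', fun g => ?_⟩
    simp only [Submodule.coe_add, Pi.add_apply, hw g, hw' g, map_add]
    abel
  smul_mem' := by
    rintro a b ⟨w, hw⟩
    refine ⟨a • w, fun g => ?_⟩
    simp only [Submodule.coe_smul, Pi.smul_apply, hw g, map_smul, smul_sub]

/-- The first reduced cohomology: the quotient of `Z¹(G, π)` by the closure of `B¹(G, π)`. -/
abbrev ReducedCohomologyOne {G : Type u} [Group G] {H : Type v} [NormedAddCommGroup H]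
    [InnerProductSpace ℂ H] (π : G →* (H ≃ₗᵢ[ℂ] H)) : Type (max u v) :=
  cocyclesOne π ⧸ (coboundariesOne π).topologicalClosure

end Cohomology

/-- Shalom's property `H_FD`: every unitary representation on a complex Hilbert space with
non-zero first reduced cohomology has a non-zero finite dimensional subrepresentation. -/
def HasPropertyHFD (G : Type u) [Group G] : Prop :=
  ∀ (H : Type u) [NormedAddCommGroup H] [InnerProductSpace ℂ H] [CompleteSpace H]
    (π : G →* (H ≃ₗᵢ[ℂ] H)), Nontrivial (ReducedCohomologyOne π) →
      ∃ V : Submodule ℂ H, V ≠ ⊥ ∧ FiniteDimensional ℂ V ∧ ∀ g : G, ∀ w ∈ V, π g w ∈ V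

/-!
The group `G = Sym(ℤ) ⋊ ℤ` acts faithfully on `ℤ`: finitely supported permutations act tautologically
and the generator `t` of `ℤ` acts as the shift `x ↦ x + 1` (`permHom`). Under this action `G` is
generated by `t` and the transposition `s = (0 1)`, since conjugating `s` by powers of `t` gives all
adjacent transpositions. The kernel of the projection to `ℤ` is `Sym(ℤ)`, which is locally finite
because finitely many elements move only finitely many integers.

Property `H_FD` fails for the permutation representation `π` of `G` on `ℓ²(ℤ)`.
* The formal vector `ξ(x) = x` is not in `ℓ²(ℤ)`, but `(ξ - g ξ)(x) = x - g⁻¹ x` differs from the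
  integer `deg g` only at finitely many `x`, where `deg : G → ℤ` is the projection. Subtracting this
  constant gives a cocycle `b` with values in `ℓ²(ℤ)` (`displacementCocycle`), and `b(t) = 0`.
* The continuous functional `c ↦ c(s)(1) - c(t)(1)` on cocycles vanishes on coboundaries: for
  `c(g) = w - π_g w`, both terms are `w(1) - w(0)`. Its value at `b` is `1`, so `b` is not in the closure
  of the coboundaries (`displacementCocycle_notMem_closure`).
* A non-zero `ℓ²` vector `w` is not constant, so if it lies in an invariant subspace `V`, subtracting
  from `w` its image under a suitable transposition puts some multiple of `δ_a - δ_c` into `V`. Then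
  `δ_a - δ_d ∈ V` for all `d ≠ a`, so `V` is infinite-dimensional
  (`not_finiteDimensional_of_invariant`).
-/

open Equiv (Perm swap)

/-! ### The action on the integers -/

/-- The shift `x ↦ x + 1`. -/
def shift : Perm ℤ := Equiv.addRight 1

lemma shift_zpow_apply (n x : ℤ) : (shift ^ n) x = x + n := by
  simp [shift]

/-- The action of `Sym(ℤ) ⋊ ℤ` on `ℤ`, the generator of `ℤ` acting as the shift. -/
def permHom : SymZExt →* Perm ℤ :=
  SemidirectProduct.lift SymZ.subtype (zpowersHom (Perm ℤ) shift) (by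
    intro g
    ext σ : 1
    rfl)

lemma permHom_eq (g : SymZExt) : permHom g = g.left.1 * shift ^ g.right.toAdd := rfl

lemma permHom_inv_apply (g : SymZExt) (x : ℤ) :
    (permHom g)⁻¹ x = g.left.1⁻¹ x - g.right.toAdd := by
  rw [permHom_eq, mul_inv_rev, Equiv.Perm.mul_apply, ← zpow_neg, shift_zpow_apply, sub_eq_add_neg]

lemma permHom_injective : Function.Injective permHom := by
  rw [injective_iff_map_eq_one]
  intro g hg
  have key : ∀ x, g.left.1⁻¹ x - g.right.toAdd = x := fun x => by
    rw [← permHom_inv_apply, hg]; simp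
  -- far from its support the finitely supported part is trivial, which detects the shift
  obtain ⟨x, hx⟩ : ∃ x, g.left.1 x = x := by
    by_contra! h
    exact Set.infinite_univ ((show {x : ℤ | g.left.1 x ≠ x}.Finite from g.left.2).subset
      fun x _ => h x)
  have hx' : g.left.1⁻¹ x = x := Equiv.Perm.inv_eq_iff_eq.mpr hx.symm
  have hr : g.right.toAdd = 0 := by
    have := key x
    rw [hx'] at this
    omega
  have hl : g.left.1 = 1 := by
    rw [permHom_eq, hr, zpow_zero, mul_one] at hg
    exact hg
  ext1
  · exact Subtype.ext hl
  · exact hr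

lemma swap_mem_symZ (x y : ℤ) : swap x y ∈ SymZ :=
  (Set.toFinite {x, y}).subset fun z hz => by
    by_contra h
    simp only [Set.mem_insert_iff, Set.mem_singleton_iff, not_or] at h
    exact hz (Equiv.swap_apply_of_ne_of_ne h.1 h.2)

/-- The transposition `(x y)` as an element of `Sym(ℤ) ⋊ ℤ`. -/
def transposition (x y : ℤ) : SymZExt := SemidirectProduct.inl ⟨swap x y, swap_mem_symZ x y⟩

/-- The generator of `ℤ` as an element of `Sym(ℤ) ⋊ ℤ`. -/
def translation : SymZExt := SemidirectProduct.inr (Multiplicative.ofAdd 1)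

@[simp] lemma permHom_transposition (x y : ℤ) : permHom (transposition x y) = swap x y :=
  SemidirectProduct.lift_inl ..

@[simp] lemma permHom_translation : permHom translation = shift := by
  simp [permHom, translation]

/-! ### Finite generation and local finiteness -/

lemma swap_mem_closure (x y : ℤ) : swap x y ∈ Subgroup.closure {shift, swap (0 : ℤ) 1} := by
  set E := Subgroup.closure {shift, swap (0 : ℤ) 1}
  have hs : shift ∈ E := Subgroup.subset_closure (by simp)
  have hadj : ∀ n : ℤ, swap n (n + 1) ∈ E := fun n => by
    have h : swap n (n + 1) = shift ^ n * swap 0 1 * (shift ^ n)⁻¹ := by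
      rw [← Equiv.swap_apply_apply, shift_zpow_apply, shift_zpow_apply, zero_add, add_comm 1]
    rw [h]
    exact E.mul_mem (E.mul_mem (E.zpow_mem hs n) (Subgroup.subset_closure (by simp)))
      (E.inv_mem (E.zpow_mem hs n))
  have hpos : ∀ (k : ℕ) (z : ℤ), swap z (z + k) ∈ E := fun k z => by
    induction k with
    | zero =>
      rw [Nat.cast_zero, add_zero, Equiv.swap_self]
      exact E.one_mem
    | succ k ih =>
      rcases Nat.eq_zero_or_pos k with rfl | hk
      · simpa using hadj z
      have h : swap z (z + (k + 1 : ℕ)) =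
          swap (z + k) (z + k + 1) * swap z (z + k) * (swap (z + k) (z + k + 1))⁻¹ := by
        rw [← Equiv.swap_apply_apply, Equiv.swap_apply_left,
          Equiv.swap_apply_of_ne_of_ne (by omega) (by omega)]
        push_cast
        rw [add_assoc]
      rw [h]
      exact E.mul_mem (E.mul_mem (hadj _) ih) (E.inv_mem (hadj _))
  rcases le_total x y with h | h
  · obtain ⟨k, rfl⟩ := Int.le.dest h
    exact hpos k x
  · obtain ⟨k, rfl⟩ := Int.le.dest h
    rw [Equiv.swap_comm]
    exact hpos k y

lemma closure_translation_transposition :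
    Subgroup.closure {translation, transposition 0 1} = ⊤ := by
  apply Subgroup.map_injective permHom_injective
  rw [MonoidHom.map_closure, Set.image_pair, permHom_translation, permHom_transposition]
  refine le_antisymm ?_ ?_
  · rw [Subgroup.closure_le]
    rintro _ (rfl | rfl)
    · exact ⟨translation, trivial, permHom_translation⟩
    · exact ⟨transposition 0 1, trivial, permHom_transposition 0 1⟩
  · rintro _ ⟨g, -, rfl⟩
    rw [permHom_eq]
    refine Subgroup.mul_mem _ ?_
      (Subgroup.zpow_mem _ (Subgroup.subset_closure (by simp)) _)
    have hsw : Subgroup.closure {σ : Perm ℤ | σ.IsSwap} ≤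
        Subgroup.closure {shift, swap (0 : ℤ) 1} := by
      rw [Subgroup.closure_le]
      rintro _ ⟨x, y, -, rfl⟩
      exact swap_mem_closure x y
    exact hsw (mem_closure_isSwap'.mpr g.left.2)

lemma symZExt_fg : Group.FG SymZExt :=
  Group.fg_iff.mpr ⟨_, closure_translation_transposition, Set.toFinite _⟩

lemma finite_setOf_eq_of_notMem {α : Type*} {F : Set α} (hF : F.Finite) :
    {σ : Perm α | ∀ x ∉ F, σ x = x}.Finite := by
  classical
  have : Finite F := hF
  exact Finite.of_equiv _ (Perm.subtypeEquivSubtypePerm (· ∈ F))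

lemma symZExt_isLocallyFiniteByZ : IsLocallyFiniteByZ SymZExt := by
  refine ⟨SemidirectProduct.rightHom, SemidirectProduct.rightHom_surjective, fun s hs => ?_⟩
  let F : Set ℤ := ⋃ g ∈ s, {x | permHom g.1 x ≠ x}
  have hF : F.Finite := hs.biUnion fun g _ => by
    have hg : g.1.right = 1 := g.2
    rw [permHom_eq, hg, toAdd_one, zpow_zero, mul_one]
    exact g.1.left.2
  -- the pointwise stabilizer of the complement of `F`
  let K : Subgroup (Perm ℤ) :=
    { carrier := {σ | ∀ x ∉ F, σ x = x}
      one_mem' := fun _ _ => rfl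
      mul_mem' := fun {σ τ} hσ hτ x hx => by rw [Equiv.Perm.mul_apply, hτ x hx, hσ x hx]
      inv_mem' := fun {σ} hσ x hx => Equiv.Perm.inv_eq_iff_eq.mpr (hσ x hx).symm }
  refine ⟨K.comap (permHom.comp (Subgroup.subtype _)), fun g hg x hx => ?_, ?_⟩
  · by_contra h
    exact hx (Set.mem_biUnion hg h)
  · exact Set.Finite.preimage (f := permHom ∘ Subtype.val) (s := K)
      (permHom_injective.comp Subtype.val_injective).injOn (finite_setOf_eq_of_notMem hF)

/-! ### The permutation representation on square-summable sequences -/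

/-- The Hilbert space `ℓ²(ℤ)`. -/
abbrev EllTwo : Type := lp (fun _ : ℤ => ℂ) 2

lemma memlp_comp_perm (σ : Perm ℤ) (f : EllTwo) :
    Memℓp (fun x => (f (σ x) : ℂ)) 2 := by
  rw [memℓp_gen_iff (by norm_num)]
  exact σ.summable_iff.mpr ((memℓp_gen_iff (by norm_num)).mp (lp.memℓp f))

/-- The permutation representation of `Perm ℤ` on `ℓ²(ℤ)`, given by `(σ f)(x) = f (σ⁻¹ x)`. -/
noncomputable def permRep : Perm ℤ →* (EllTwo ≃ₗᵢ[ℂ] EllTwo) where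
  toFun σ :=
    { toFun f := ⟨fun x => f (σ⁻¹ x), memlp_comp_perm σ⁻¹ f⟩
      invFun f := ⟨fun x => f (σ x), memlp_comp_perm σ f⟩
      map_add' _ _ := rfl
      map_smul' _ _ := rfl
      left_inv f := by ext x; simp
      right_inv f := by ext x; simp
      norm_map' f := by
        rw [lp.norm_eq_tsum_rpow (by norm_num), lp.norm_eq_tsum_rpow (by norm_num)]
        congr 1
        exact (σ⁻¹).tsum_eq fun x => ‖f x‖ ^ (2 : ENNReal).toReal }
  map_one' := rfl
  map_mul' σ τ := by
    ext f x
    change f ((σ * τ)⁻¹ x) = f (τ⁻¹ (σ⁻¹ x))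
    rw [mul_inv_rev, Equiv.Perm.mul_apply]

lemma permRep_apply (σ : Perm ℤ) (f : EllTwo) (x : ℤ) : permRep σ f x = f (σ⁻¹ x) := rfl

/-- The unitary representation of `Sym(ℤ) ⋊ ℤ` on `ℓ²(ℤ)` induced by the action on `ℤ`. -/
noncomputable def ellTwoRep : SymZExt →* (EllTwo ≃ₗᵢ[ℂ] EllTwo) := permRep.comp permHom

lemma ellTwoRep_apply (g : SymZExt) (f : EllTwo) (x : ℤ) :
    ellTwoRep g f x = f ((permHom g)⁻¹ x) := rfl

lemma sub_permRep_swap (f : EllTwo) (x y : ℤ) :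
    f - permRep (swap x y) f =
      (f x - f y) • (lp.single 2 x (1 : ℂ) - lp.single 2 y (1 : ℂ) : EllTwo) := by
  ext z
  simp only [lp.coeFn_sub, lp.coeFn_smul, Pi.sub_apply, Pi.smul_apply, permRep_apply,
    Equiv.swap_inv, smul_eq_mul, lp.single_apply]
  by_cases hx : z = x
  · subst hx
    by_cases hy : z = y
    · subst hy; simp
    · simp [hy]
  · by_cases hy : z = y
    · subst hy
      simp [hx]
    · simp [hx, hy, Equiv.swap_apply_of_ne_of_ne]

lemma exists_apply_ne {f : EllTwo} (hf : f ≠ 0) : ∃ x y, f x ≠ f y := by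
  by_contra! h
  apply hf
  have hs := (memℓp_gen_iff (p := 2) (by norm_num)).mp (lp.memℓp f)
  ext x
  have h0 : (fun i => ‖f i‖ ^ (2 : ENNReal).toReal) =
      fun _ => ‖f x‖ ^ (2 : ENNReal).toReal := by
    funext i; rw [h i x]
  rw [h0, summable_const_iff] at hs
  simpa using hs

/-- A subspace of `ℓ²(ℤ)` invariant under transpositions is zero or infinite-dimensional. -/
lemma not_finiteDimensional_of_invariant (V : Submodule ℂ EllTwo) (hV : V ≠ ⊥)
    (hinv : ∀ x y : ℤ, ∀ w ∈ V, permRep (swap x y) w ∈ V) : ¬ FiniteDimensional ℂ V := by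
  intro hfin
  obtain ⟨f, hfV, hf⟩ := V.ne_bot_iff.mp hV
  obtain ⟨a, c, hac⟩ := exists_apply_ne hf
  have hdiff : ∀ w ∈ V, ∀ x y, w x ≠ w y →
      (lp.single 2 x (1 : ℂ) - lp.single 2 y (1 : ℂ) : EllTwo) ∈ V := fun w hw x y hxy => by
    have h := V.sub_mem hw (hinv x y w hw)
    rwa [sub_permRep_swap, V.smul_mem_iff (sub_ne_zero.mpr hxy)] at h
  have hmem : ∀ d, d ≠ a → (lp.single 2 a (1 : ℂ) - lp.single 2 d (1 : ℂ) : EllTwo) ∈ V := by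
    intro d hd
    by_cases hdc : f a = f d
    · -- as `f` separates `d` from `c`, the vector `δ_a - δ_c` separates `a` from `d`
      have hca : c ≠ a := fun h => hac (by rw [h])
      have hcd : d ≠ c := fun h => hac (by rw [hdc, h])
      refine hdiff _ (hdiff f hfV a c hac) a d ?_
      simp [lp.single_apply, hd, hcd, hca.symm]
    · exact hdiff f hfV a d hdc
  let u : {d : ℤ // d ≠ a} → V := fun d => ⟨_, hmem d d.2⟩
  have hu : LinearIndependent ℂ u := by
    rw [linearIndependent_iff']
    intro s k hk i hi
    have h := congrArg (fun w : V => (w : EllTwo) i) hk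
    simp only [u, Submodule.coe_sum, Submodule.coe_smul, lp.coeFn_sum, Finset.sum_apply,
      lp.coeFn_smul, lp.coeFn_sub, Pi.smul_apply, Pi.sub_apply, lp.single_apply, smul_eq_mul,
      Submodule.coe_zero, lp.coeFn_zero, Pi.zero_apply] at h
    rw [Finset.sum_eq_single i] at h
    · simpa [Pi.single_apply, i.2] using h
    · intro j _ hj
      have : (i : ℤ) ≠ j := fun h => hj (Subtype.ext h.symm)
      simp [i.2, this]
    · exact fun h => absurd hi h
  have hfi : Finite {d : ℤ // d ≠ a} := hu.finite
  exact (Set.finite_singleton a).infinite_compl hfi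

/-! ### A cocycle outside the closure of the coboundaries -/

lemma finite_setOf_displacement_ne (g : SymZExt) :
    {x : ℤ | x - (permHom g)⁻¹ x - g.right.toAdd ≠ 0}.Finite := by
  refine (show {x : ℤ | g.left.1⁻¹ x ≠ x}.Finite from SymZ.inv_mem g.left.2).subset ?_
  intro x hx h
  apply hx
  rw [permHom_inv_apply, h]
  ring

/-- The formal coboundary `g ↦ ξ - g ξ` of the unbounded function `ξ(x) = x`, with the constant
`deg g` subtracted so that its values are finitely supported. -/
noncomputable def displacement (g : SymZExt) : EllTwo :=
  ⟨fun x => ((x - (permHom g)⁻¹ x - g.right.toAdd : ℤ) : ℂ), by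
    refine (memℓp_gen_iff (by norm_num)).mpr ?_
    refine summable_of_hasFiniteSupport ((finite_setOf_displacement_ne g).subset ?_)
    intro x hx h
    apply hx
    change ‖((_ : ℤ) : ℂ)‖ ^ (2 : ENNReal).toReal = 0
    rw [h]
    simp⟩

lemma displacement_apply (g : SymZExt) (x : ℤ) :
    displacement g x = ((x - (permHom g)⁻¹ x - g.right.toAdd : ℤ) : ℂ) := rfl

/-- The map `displacement` as an element of `Z¹(G, ℓ²(ℤ))`. -/
noncomputable def displacementCocycle : cocyclesOne ellTwoRep :=
  ⟨displacement, fun g h => by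
    ext x
    rw [lp.coeFn_add, Pi.add_apply, ellTwoRep_apply, displacement_apply, displacement_apply,
      displacement_apply, map_mul, mul_inv_rev, Equiv.Perm.mul_apply,
      SemidirectProduct.mul_right, toAdd_mul]
    push_cast
    ring⟩

lemma displacementCocycle_notMem_closure :
    displacementCocycle ∉ (coboundariesOne ellTwoRep).topologicalClosure := by
  let φ : cocyclesOne ellTwoRep → ℂ := fun c =>
    lp.evalCLM ℂ (fun _ : ℤ => ℂ) 2 1 (c.1 (transposition 0 1)) -
      lp.evalCLM ℂ (fun _ : ℤ => ℂ) 2 1 (c.1 translation)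
  have hφ : Continuous φ :=
    ((lp.evalCLM ℂ (fun _ : ℤ => ℂ) 2 1).continuous.comp
      ((continuous_apply _).comp continuous_subtype_val)).sub
    ((lp.evalCLM ℂ (fun _ : ℤ => ℂ) 2 1).continuous.comp
      ((continuous_apply _).comp continuous_subtype_val))
  have hshift : shift⁻¹ (1 : ℤ) = 0 := by simp [shift]
  intro hmem
  have hzero : (coboundariesOne ellTwoRep : Set (cocyclesOne ellTwoRep)) ⊆ φ ⁻¹' {0} := by
    rintro c ⟨w, hw⟩
    change c.1 (transposition 0 1) 1 - c.1 translation 1 = 0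
    rw [hw, hw, lp.coeFn_sub, lp.coeFn_sub, Pi.sub_apply, Pi.sub_apply, ellTwoRep_apply,
      ellTwoRep_apply, permHom_transposition, permHom_translation, hshift, Equiv.swap_inv,
      Equiv.swap_apply_right, sub_self]
  have h := closure_minimal hzero (isClosed_singleton.preimage hφ) hmem
  change displacement (transposition 0 1) 1 - displacement translation 1 = 0 at h
  rw [displacement_apply, displacement_apply, permHom_transposition, permHom_translation, hshift,
    Equiv.swap_inv, Equiv.swap_apply_right] at h
  simp [transposition, translation] at h

lemma nontrivial_reducedCohomologyOne : Nontrivial (ReducedCohomologyOne ellTwoRep) :=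
  Submodule.Quotient.nontrivial_iff.mpr fun h =>
    displacementCocycle_notMem_closure (h ▸ Submodule.mem_top)

theorem proposition4p5 :
    Group.FG SymZExt ∧ IsLocallyFiniteByZ SymZExt ∧ ¬ HasPropertyHFD SymZExt := by
  refine ⟨symZExt_fg, symZExt_isLocallyFiniteByZ, fun h => ?_⟩
  obtain ⟨V, hV, hfin, hinv⟩ := h EllTwo ellTwoRep nontrivial_reducedCohomologyOne
  refine not_finiteDimensional_of_invariant V hV (fun x y w hw => ?_) hfin
  have := hinv (transposition x y) w hw
  rwa [ellTwoRep, MonoidHom.comp_apply, permHom_transposition] at this
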